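/- Let $n\ge 1$ and $[n]=\{0,\dots,n-1\}$. For $i\neq j$ in $[n]$ let $x_{i,j}$ be a literal, where $x_{j,i}$ is identified with $\overline{x_{i,j}}$ (only the variables $x_{i,j}$ with $i<j$ actually exist). Clauses are finite sets of literals. For distinct $i,j,k$ put $T_{i,j,k}=\overline{x_{i,j}}\vee\overline{x_{j,k}}\vee\overline{x_{k,i}}$. Let $r,s:[n]^3\to[n]$ be guard functions, i.e. for all distinct $i,j,k$ we have $r(i,j,k)\ne s(i,j,k)$ and $\{r(i,j,k),s(i,j,k)\}\not\subseteq\{i,j,k\}$. The guarded graph tautology formula $\mathrm{GGT}_n$ (for $r,s$) is the set of the clauses $\bigvee_{j\ne i}x_{j,i}$ for all $i\in[n]$, and of the clauses $T_{i,j,k}\vee x_{r,s}$ and $T_{i,j,k}\vee\overline{x_{r,s}}$ for all distinct $i,j,k\in[n]$, where $r=r(i,j,k)$ and $s=s(i,j,k)$. A pool resolution (regRTL) refutation of a set $F$ of clauses is a binary tree with nodes labeled by clauses such that: the root is labeled by the empty clause; each leaf is labeled by a clause of $F$ or by a clause that labels an earlier node in the postorder of the tree (left subtree, right subtree, root); each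 internal node is also labeled by a literal $x$, and its clause is obtained from the clauses $A$ and $B$ of its left and right child by the ordinary (non-degenerate) resolution rule on $x$, i.e. $x\in A$, $\overline x\notin A$, $\overline x\in B$, $x\notin B$, and the resolvent is $(A\setminus\{x\})\cup(B\setminus\{\overline x\})$; and on every path from the root to a leaf each variable is resolved on at most once. Its number of lines is the number of nodes, and its size is the sum over all nodes of the number of literals of the clause, plus one. Theorem. The formulas $\mathrm{GGT}_n$ have polynomial size pool resolution refutations. More precisely, there is a constant $c$ such that for every $n\ge1$ and all guard functions $r,s$ on $[n]^3$, $\mathrm{GGT}_n$ has a pool resolution (regRTL) refutation with at most $c\,n^6$ lines and of size at most $c\,n^8$. -/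

import Mathlib

namespace PoolRes

/-! ### Literals, clauses and the resolution rule -/

/-- A literal over the variables `V`: `(v, true)` is `v` and `(v, false)` is the negation of `v`. -/
abbrev Literal (V : Type*) := V × Bool

/-- The complementary literal. -/
def Literal.neg {V : Type*} (x : Literal V) : Literal V := (x.1, !x.2)

/-- A clause is a finite set of literals, read as their disjunction. -/
abbrev Clause (V : Type*) := Finset (Literal V)

/-- The ordinary (non-degenerate) resolution rule: `A` contains `x` and not its complement, `B`
contains the complement of `x` and not `x`, and `C` is the union of what remains of `A` and `B`
when `x` and its complement, respectively, are removed. -/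
def IsResolvent {V : Type*} [DecidableEq V] (A B : Clause V) (x : Literal V) (C : Clause V) :
    Prop :=
  x ∈ A ∧ x.neg ∈ B ∧ x.neg ∉ A ∧ x ∉ B ∧ C = A.erase x ∪ B.erase x.neg

/-! ### Proof trees and pool resolution -/

/-- Binary trees whose leaves are labeled with clauses and whose internal nodes are labeled with
a clause and a literal. -/
inductive ProofTree (V : Type*) where
  | leaf (C : Clause V) : ProofTree V
  | node (C : Clause V) (x : Literal V) (left right : ProofTree V) : ProofTree V

namespace ProofTree

variable {V : Type*}

/-- The clause that labels the root. -/
def conclusion : ProofTree V → Clause V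
  | leaf C => C
  | node C _ _ _ => C

/-- The clauses labeling the nodes, one entry for each node, in postorder: first the left
subtree, then the right subtree, then the root. -/
def postorder : ProofTree V → List (Clause V)
  | leaf C => [C]
  | node C _ l r => l.postorder ++ r.postorder ++ [C]

/-- The variables that are resolved on somewhere in the tree. -/
def resVars : ProofTree V → Set V
  | leaf _ => ∅
  | node _ x l r => {x.1} ∪ l.resVars ∪ r.resVars

/-- Every leaf is labeled with a clause of `F`, with a clause of `prev`, or with a clause that
labels an earlier node in postorder. (The nodes of a tree that come before a given leaf in
postorder are the nodes of the left subtrees at those ancestors of the leaf that have the leaf in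
their right subtree.) For a whole tree, `prev` is empty. -/
def LeavesOK (F : Set (Clause V)) : Set (Clause V) → ProofTree V → Prop
  | prev, leaf C => C ∈ F ∨ C ∈ prev
  | prev, node _ _ l r => l.LeavesOK F prev ∧ r.LeavesOK F (prev ∪ {D | D ∈ l.postorder})

/-- Every internal node is obtained from its two children by the resolution rule, resolving on
the literal that labels the node. -/
def InferencesOK [DecidableEq V] : ProofTree V → Prop
  | leaf _ => True
  | node C x l r =>
      IsResolvent l.conclusion r.conclusion x C ∧ l.InferencesOK ∧ r.InferencesOK

/-- No variable is resolved on twice along a path from the root to a leaf. -/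
def PathRegular : ProofTree V → Prop
  | leaf _ => True
  | node _ x l r => x.1 ∉ l.resVars ∧ x.1 ∉ r.resVars ∧ l.PathRegular ∧ r.PathRegular

/-- The number of lines of a proof: the number of nodes of the tree. -/
def lines (T : ProofTree V) : ℕ := T.postorder.length

/-- The size of a proof: every line counts its number of literals plus one. -/
def size (T : ProofTree V) : ℕ := (T.postorder.map fun C => C.card + 1).sum

end ProofTree

/-- `T` is a pool resolution (regRTL) proof of the clause `C` from the set of clauses `F`. -/
structure IsPoolProof {V : Type*} [DecidableEq V] (F : Set (Clause V)) (C : Clause V)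
    (T : ProofTree V) : Prop where
  conclusion_eq : T.conclusion = C
  leaves : T.LeavesOK F ∅
  inferences : T.InferencesOK
  regular : T.PathRegular
  /-- no variable of the conclusion is resolved on -/
  conclusion_regular : ∀ x ∈ C, x.1 ∉ T.resVars

/-- `T` is a pool resolution (regRTL) refutation of the set of clauses `F`. -/
def IsPoolRefutation {V : Type*} [DecidableEq V] (F : Set (Clause V)) (T : ProofTree V) : Prop :=
  IsPoolProof F ∅ T

/-! ### Guarded graph tautologies -/

/-- The variables `x_{i,j}` that actually exist: those with `i < j`. -/
abbrev EdgeVar (n : ℕ) := {p : Fin n × Fin n // p.1 < p.2}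

/-- The literal `x_{i,j}` for `i ≠ j`: the variable `x_{i,j}` if `i < j`, and the negation of the
variable `x_{j,i}` if `j < i`. -/
def lit {n : ℕ} (i j : Fin n) (h : i ≠ j) : Literal (EdgeVar n) :=
  if hij : i < j then (⟨(i, j), hij⟩, true)
  else (⟨(j, i), lt_of_le_of_ne (not_lt.mp hij) h.symm⟩, false)

/-- `x_{j,i}` is the negation of `x_{i,j}`. -/
theorem lit_symm {n : ℕ} (i j : Fin n) (h : i ≠ j) : lit j i h.symm = (lit i j h).neg := by
  rcases lt_or_gt_of_ne h with h1 | h1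
  · simp [lit, Literal.neg, h1, h1.not_gt]
  · simp [lit, Literal.neg, h1, h1.not_gt]

/-- The clause `⋁_{j ≠ i} x_{j,i}`. -/
def alphaClause {n : ℕ} (i : Fin n) : Clause (EdgeVar n) :=
  Finset.univ.image fun j : {j : Fin n // j ≠ i} => lit j.1 i j.2

/-- The transitivity clause `T_{i,j,k}`, that is `¬x_{i,j} ∨ ¬x_{j,k} ∨ ¬x_{k,i}`. -/
def transClause {n : ℕ} (i j k : Fin n) (hij : i ≠ j) (hjk : j ≠ k) (hki : k ≠ i) :
    Clause (EdgeVar n) :=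
  {(lit i j hij).neg, (lit j k hjk).neg, (lit k i hki).neg}

/-- The requirement on the guard functions `r` and `s`: for all distinct `i, j, k` one has
`r(i,j,k) ≠ s(i,j,k)`, and `{r(i,j,k), s(i,j,k)}` is not a subset of `{i,j,k}`. -/
def IsGuard {n : ℕ} (r s : Fin n → Fin n → Fin n → Fin n) : Prop :=
  ∀ i j k : Fin n, i ≠ j → j ≠ k → k ≠ i →
    r i j k ≠ s i j k ∧ ¬ (({r i j k, s i j k} : Set (Fin n)) ⊆ {i, j, k})

/-- The guarded graph tautology formula `GGT_n` for the guard functions `r` and `s`: the clauses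
`⋁_{j ≠ i} x_{j,i}` for all `i`, and the clauses `T_{i,j,k} ∨ x_{r,s}` and `T_{i,j,k} ∨ ¬x_{r,s}`
for all distinct `i, j, k`, where `r = r(i,j,k)` and `s = s(i,j,k)`. -/
def GGT (n : ℕ) (r s : Fin n → Fin n → Fin n → Fin n) : Set (Clause (EdgeVar n)) :=
  {C | ∃ i : Fin n, C = alphaClause i} ∪
  {C | ∃ (i j k : Fin n) (hij : i ≠ j) (hjk : j ≠ k) (hki : k ≠ i) (hrs : r i j k ≠ s i j k),
    C = insert (lit (r i j k) (s i j k) hrs) (transClause i j k hij hjk hki) ∨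
    C = insert (lit (r i j k) (s i j k) hrs).neg (transClause i j k hij hjk hki)}

end PoolRes

/-! Read `(a, b) ∈ P` as an edge from `a` to `b`, that is, as the assignment making $x_{a,b}$ true.
The refutation is a depth-first search over such partial assignments `P`, which record the branch
decisions on the path from the root. Below `P` only variables free in `P` are resolved on, which
gives regularity. The clause concluded there is falsified by `P` and contains the literals of all
edges of `P` that leave a minimal element (`Covers`). The latter guarantees that the literals
branched on do occur, so that no resolution degenerates.

If all transitivity clauses that are needed are available up to literals falsified by `P`, the
standard regular refutation of the unguarded graph tautology, run on the minimal elements of `P`,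
finishes the branch (`exists_covers_of_avail`). A clause $T_{i,j,k}$ is available if it has been
learned or if `P` sets its guard variable, since then one of its two guarded versions has a
falsified guard literal.

Otherwise the guard variable of some needed $T_{i,j,k}$ is free. The search branches on the
variables of the triangle not set by `P`, so that the leftmost branch falsifies $T_{i,j,k}$, and
derives this clause there by resolving on the guard variable, which is not a variable of the
triangle (`exists_learn`). Being early in postorder, the clause can be reused everywhere later. At
most $n^3$ triples are learned this way, and each pays for at most three recursive subproblems
(`solvable_of_unknown_src`, `solvable_of_unknown_edge`). Such branching may destroy the property
that each non-minimal element has a minimal predecessor; the weaker `Reach` survives, and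
`solvable_of_undominated` repairs the property at four lines per element. -/

namespace PoolRes

open ProofTree

/-! ### Literals as ordered pairs -/

section Literals

variable {n : ℕ}

theorem lit_neg {a b : Fin n} (h : a ≠ b) : (lit a b h).neg = lit b a h.symm :=
  (lit_symm a b h).symm

theorem lit_inj {a b c d : Fin n} {h : a ≠ b} {h' : c ≠ d} :
    lit a b h = lit c d h' ↔ a = c ∧ b = d := by
  refine ⟨fun e => ?_, fun ⟨h1, h2⟩ => by subst h1 h2; rfl⟩
  unfold lit at e
  split_ifs at e <;> simp at e <;> tauto

theorem exists_eq_lit (x : Literal (EdgeVar n)) : ∃ (a b : Fin n) (h : a ≠ b), x = lit a b h := by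
  obtain ⟨⟨⟨i, j⟩, hij⟩, b⟩ := x
  cases b
  · exact ⟨j, i, (ne_of_lt hij).symm, by simp [lit, (show i < j from hij).not_gt]⟩
  · exact ⟨i, j, ne_of_lt hij, by simp [lit, show i < j from hij]⟩

theorem lit_var (a b : Fin n) (h : a ≠ b) :
    (lit a b h).1.1 = (a, b) ∨ (lit a b h).1.1 = (b, a) := by
  unfold lit
  split_ifs <;> simp

/-- The clause `D` contains the literal `x_{a,b}`. -/
def Has (D : Clause (EdgeVar n)) (a b : Fin n) : Prop := ∃ h : a ≠ b, lit a b h ∈ D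

theorem Has.ne {D : Clause (EdgeVar n)} {a b : Fin n} (h : Has D a b) : a ≠ b := h.1

theorem has_insert_lit {D : Clause (EdgeVar n)} {a b c d : Fin n} (h : c ≠ d) :
    Has (insert (lit c d h) D) a b ↔ (a = c ∧ b = d) ∨ Has D a b := by
  unfold Has
  simp only [Finset.mem_insert, lit_inj]
  constructor
  · rintro ⟨h, h1 | h1⟩
    · exact Or.inl h1
    · exact Or.inr ⟨h, h1⟩
  · rintro (⟨rfl, rfl⟩ | ⟨h, h1⟩)
    · exact ⟨h, Or.inl ⟨rfl, rfl⟩⟩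
    · exact ⟨h, Or.inr h1⟩

theorem has_alphaClause {i a b : Fin n} : Has (alphaClause i) a b ↔ a ≠ i ∧ b = i := by
  unfold Has alphaClause
  simp only [Finset.mem_image, Finset.mem_univ, true_and, Subtype.exists, lit_inj]
  constructor
  · rintro ⟨h, c, hc, rfl, rfl⟩
    exact ⟨hc, rfl⟩
  · rintro ⟨h, rfl⟩
    exact ⟨h, a, h, rfl, rfl⟩

theorem has_transClause {i j k a b : Fin n} {hij : i ≠ j} {hjk : j ≠ k} {hki : k ≠ i} :
    Has (transClause i j k hij hjk hki) a b ↔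
      (a = j ∧ b = i) ∨ (a = k ∧ b = j) ∨ (a = i ∧ b = k) := by
  unfold Has transClause
  simp only [lit_neg, Finset.mem_insert, Finset.mem_singleton, lit_inj]
  refine ⟨fun h => h.2, fun h => ⟨?_, h⟩⟩
  rintro rfl
  rcases h with ⟨rfl, rfl⟩ | ⟨rfl, rfl⟩ | ⟨rfl, rfl⟩ <;> contradiction

theorem eq_empty_of_not_has {D : Clause (EdgeVar n)} (h : ∀ a b, ¬ Has D a b) : D = ∅ := by
  refine Finset.eq_empty_of_forall_notMem fun x hx => ?_
  obtain ⟨a, b, hab, rfl⟩ := exists_eq_lit x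
  exact h a b ⟨hab, hx⟩

/-- Resolution on `x_{a,b}`, in terms of the literals that the clauses contain. -/
theorem exists_resolvent {A B : Clause (EdgeVar n)} {a b : Fin n} (hab : a ≠ b)
    (hA : Has A a b) (hA' : ¬ Has A b a) (hB : Has B b a) (hB' : ¬ Has B a b) :
    ∃ C, IsResolvent A B (lit a b hab) C ∧ ∀ c d, Has C c d ↔
      (Has A c d ∧ ¬ (c = a ∧ d = b)) ∨ (Has B c d ∧ ¬ (c = b ∧ d = a)) := by
  refine ⟨_, ⟨hA.2, ?_, ?_, fun h => hB' ⟨hab, h⟩, rfl⟩, fun c d => ?_⟩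
  · rw [lit_neg]; exact hB.2
  · rw [lit_neg]; exact fun h => hA' ⟨hab.symm, h⟩
  · unfold Has
    simp only [lit_neg, Finset.mem_union, Finset.mem_erase, ne_eq, lit_inj]
    constructor
    · rintro ⟨h, h1 | h1⟩
      · exact Or.inl ⟨⟨h, h1.2⟩, h1.1⟩
      · exact Or.inr ⟨⟨h, h1.2⟩, h1.1⟩
    · rintro (⟨⟨h, h1⟩, h2⟩ | ⟨⟨h, h1⟩, h2⟩)
      · exact ⟨h, Or.inl ⟨h2, h1⟩⟩
      · exact ⟨h, Or.inr ⟨h2, h1⟩⟩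

end Literals

/-! ### Derivations that start from known clauses and resolve on prescribed variables -/

theorem ProofTree.LeavesOK.mono {V : Type*} {F : Set (Clause V)} {T : ProofTree V} :
    ∀ {Q Q' : Set (Clause V)}, Q ⊆ Q' → T.LeavesOK F Q → T.LeavesOK F Q' := by
  induction T with
  | leaf C => exact fun h h1 => h1.imp_right fun h2 => h h2
  | node C x l r ihl ihr =>
    exact fun h h1 => ⟨ihl h h1.1, ihr (Set.union_subset_union_left _ h) h1.2⟩

/-- Allows learned clauses to be treated as axioms while a derivation is built, and turned back into
known clauses afterwards. -/
theorem ProofTree.LeavesOK.of_union {V : Type*} {F G : Set (Clause V)} {T : ProofTree V} :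
    ∀ {Q : Set (Clause V)}, T.LeavesOK (F ∪ G) Q → T.LeavesOK F (G ∪ Q) := by
  induction T with
  | leaf C => rintro Q ((h | h) | h); exacts [Or.inl h, Or.inr (Or.inl h), Or.inr (Or.inr h)]
  | node C x l r ihl ihr =>
    intro Q h
    exact ⟨ihl h.1, (ihr h.2).mono (by rw [Set.union_assoc])⟩

theorem ProofTree.conclusion_mem_postorder {V : Type*} (T : ProofTree V) :
    T.conclusion ∈ T.postorder := by
  cases T <;> simp [conclusion, postorder]

variable {n : ℕ}

/-- The clauses known after the tree `T`, if those in `Q` are known before it. -/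
abbrev after {V : Type*} (Q : Set (Clause V)) (T : ProofTree V) : Set (Clause V) :=
  Q ∪ {D | D ∈ T.postorder}

/-- `T` is a regular derivation from `F` and the known clauses `Q`, and it resolves only on
variables with endpoints related by `U`. -/
structure Derives (F Q : Set (Clause (EdgeVar n))) (U : Fin n → Fin n → Prop)
    (T : ProofTree (EdgeVar n)) : Prop where
  leaves : T.LeavesOK F Q
  inferences : T.InferencesOK
  regular : T.PathRegular
  vars : ∀ v ∈ T.resVars, U v.1.1 v.1.2 ∧ U v.1.2 v.1.1

theorem Derives.mono {F Q Q' : Set (Clause (EdgeVar n))} {U U' : Fin n → Fin n → Prop}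
    {T : ProofTree (EdgeVar n)} (h : Derives F Q U T) (hQ : Q ⊆ Q')
    (hU : ∀ a b, U a b → U' a b) : Derives F Q' U' T :=
  ⟨h.leaves.mono hQ, h.inferences, h.regular,
    fun v hv => ⟨hU _ _ (h.vars v hv).1, hU _ _ (h.vars v hv).2⟩⟩

theorem derives_leaf {F Q : Set (Clause (EdgeVar n))} {U : Fin n → Fin n → Prop}
    {C : Clause (EdgeVar n)} (h : C ∈ F ∨ C ∈ Q) : Derives F Q U (leaf C) :=
  ⟨h, trivial, trivial, fun _ hv => hv.elim⟩

/-- Regularity comes from `hab0`: both subtrees resolve on variables inside `U` only, and the new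
pivot lies outside. -/
theorem derives_node {F Q : Set (Clause (EdgeVar n))} {U U' : Fin n → Fin n → Prop}
    {l r : ProofTree (EdgeVar n)} {a b : Fin n} (hab : a ≠ b) {C : Clause (EdgeVar n)}
    (hl : Derives F Q U l) (hr : Derives F (after Q l) U r)
    (hC : IsResolvent l.conclusion r.conclusion (lit a b hab) C)
    (hU : ∀ c d, U c d → U' c d) (hab1 : U' a b) (hba1 : U' b a) (hab0 : ¬ (U a b ∧ U b a)) :
    Derives F Q U' (node C (lit a b hab) l r) := by
  have key : ∀ v : EdgeVar n, U v.1.1 v.1.2 ∧ U v.1.2 v.1.1 → v ≠ (lit a b hab).1 := by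
    rintro v hv rfl
    rcases lit_var a b hab with h | h <;> rw [h] at hv
    · exact hab0 hv
    · exact hab0 hv.symm
  refine ⟨⟨hl.leaves, hr.leaves⟩, ⟨hC, hl.inferences, hr.inferences⟩,
    ⟨fun h => key _ (hl.vars _ h) rfl, fun h => key _ (hr.vars _ h) rfl, hl.regular, hr.regular⟩,
    ?_⟩
  rintro v ((rfl | hv) | hv)
  · rcases lit_var a b hab with h | h <;> rw [h]
    · exact ⟨hab1, hba1⟩
    · exact ⟨hba1, hab1⟩
  · exact ⟨hU _ _ (hl.vars v hv).1, hU _ _ (hl.vars v hv).2⟩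
  · exact ⟨hU _ _ (hr.vars v hv).1, hU _ _ (hr.vars v hv).2⟩

@[simp] theorem ProofTree.lines_leaf {V : Type*} (C : Clause V) : (leaf C).lines = 1 := rfl

@[simp] theorem ProofTree.lines_node {V : Type*} (C : Clause V) (x : Literal V)
    (l r : ProofTree V) : (node C x l r).lines = l.lines + r.lines + 1 := by
  simp [lines, postorder, add_assoc]

theorem after_node {V : Type*} {Q : Set (Clause V)} (C : Clause V) (x : Literal V)
    (l r : ProofTree V) : after (after Q l) r ⊆ after Q (node C x l r) := by
  intro D hD
  simp only [after, postorder, Set.mem_union, Set.mem_ofPred_eq, List.mem_append,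
    List.mem_singleton] at hD ⊢
  tauto

theorem conclusion_mem_after {V : Type*} {Q : Set (Clause V)} (T : ProofTree V) :
    T.conclusion ∈ after Q T := Or.inr T.conclusion_mem_postorder

/-- Resolving away the literals `x_{j,i}`, for `j ∈ J`, with one known clause for each. -/
theorem exists_chain {F Q : Set (Clause (EdgeVar n))} {U : Fin n → Fin n → Prop}
    {T : ProofTree (EdgeVar n)} (hT : Derives F Q U T) (i : Fin n)
    (E : Fin n → Clause (EdgeVar n)) (J : Finset (Fin n))
    (hE : ∀ j ∈ J, E j ∈ F ∨ E j ∈ Q)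
    (hD : ∀ j ∈ J, Has T.conclusion j i) (hD' : ∀ j ∈ J, ¬ Has T.conclusion i j)
    (hEij : ∀ j ∈ J, Has (E j) i j) (hEji : ∀ j ∈ J, ∀ k ∈ J, ¬ Has (E j) k i)
    (hEik : ∀ j ∈ J, ∀ k ∈ J, Has (E j) i k → k = j)
    (hU : ∀ j ∈ J, ¬ (U j i ∧ U i j)) :
    ∃ T', Derives F Q (fun a b => U a b ∨ (b = i ∧ a ∈ J) ∨ (a = i ∧ b ∈ J)) T' ∧
      after Q T ⊆ after Q T' ∧ T'.lines = T.lines + 2 * J.card ∧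
      ∀ c d, Has T'.conclusion c d ↔ (Has T.conclusion c d ∧ ¬ (c ∈ J ∧ d = i)) ∨
        ∃ j ∈ J, Has (E j) c d ∧ ¬ (c = i ∧ d = j) := by
  induction J using Finset.induction_on with
  | empty => exact ⟨T, by simpa using hT, subset_rfl, by simp, by simp⟩
  | insert k J hk ih =>
    simp only [Finset.forall_mem_insert] at hE hD hD' hEij hU
    have hJ : ∀ j ∈ J, j ∈ insert k J := fun j hj => Finset.mem_insert_of_mem hj
    have hkk : k ∈ insert k J := Finset.mem_insert_self _ _
    obtain ⟨T', h1, h2, h3, h4⟩ := ih hE.2 hD.2 hD'.2 hEij.2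
      (fun j hj k hk => hEji j (hJ j hj) k (hJ k hk))
      (fun j hj k hk => hEik j (hJ j hj) k (hJ k hk)) hU.2
    have hki : k ≠ i := hD.1.ne
    obtain ⟨C, hC, hC'⟩ := exists_resolvent (A := T'.conclusion) (B := E k) hki
      ((h4 _ _).2 (Or.inl ⟨hD.1, fun h => hk h.1⟩))
      (by
        rw [h4]
        rintro (h | ⟨j, hj, h, -⟩)
        · exact hD'.1 h.1
        -- A side clause used earlier cannot have brought in the complement of the new pivot: the
        -- only such literal it has belongs to its own pivot.
        · exact hk (hEik j (hJ j hj) k hkk h ▸ hj))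
      hEij.1 (hEji k hkk k hkk)
    refine ⟨node C (lit k i hki) T' (leaf (E k)), derives_node hki h1
      (derives_leaf (hE.1.imp_right Or.inl)) hC ?_ ?_ ?_ ?_, ?_, ?_, ?_⟩
    · intro c d
      simp only [Finset.mem_insert]
      tauto
    · simp
    · simp
    · have := hU.1
      simp only [hk, hki, false_and, and_false, or_false]
      exact this
    · exact h2.trans ((Set.subset_union_left).trans (after_node C _ T' (leaf (E k))))
    · simp [h3, Finset.card_insert_of_notMem hk]; ring
    · intro c d
      change Has C c d ↔ _
      rw [hC', h4]
      constructor
      · rintro (⟨⟨h, h'⟩ | ⟨j, hj, h, h'⟩, h''⟩ | ⟨h, h'⟩)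
        · refine Or.inl ⟨h, fun h0 => ?_⟩
          rcases Finset.mem_insert.1 h0.1 with h5 | h5
          · exact h'' ⟨h5, h0.2⟩
          · exact h' ⟨h5, h0.2⟩
        · exact Or.inr ⟨j, hJ j hj, h, h'⟩
        · exact Or.inr ⟨k, hkk, h, h'⟩
      · rintro (⟨h, h'⟩ | ⟨j, hj, h, h'⟩)
        · exact Or.inl ⟨Or.inl ⟨h, fun h0 => h' ⟨hJ c h0.1, h0.2⟩⟩,
            fun h0 => h' ⟨h0.1 ▸ hkk, h0.2⟩⟩
        · rcases Finset.mem_insert.1 hj with rfl | hj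
          · exact Or.inr ⟨h, h'⟩
          · refine Or.inl ⟨Or.inr ⟨j, hj, h, h'⟩, ?_⟩
            rintro ⟨rfl, rfl⟩
            exact hEji j hj _ hkk h

/-! ### The refutation below a partial order in which every element has a minimal predecessor -/

/-- `a` is minimal: no edge of `P` ends in `a`. -/
def Src (P : Finset (Fin n × Fin n)) (a : Fin n) : Prop := ∀ b, (b, a) ∉ P

/-- The variable `x_{a,b}` is not set by `P`. -/
def Free (P : Finset (Fin n × Fin n)) (a b : Fin n) : Prop := (a, b) ∉ P ∧ (b, a) ∉ P

/-- `P` does not set a variable in two ways. -/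
def Asym (P : Finset (Fin n × Fin n)) : Prop := ∀ a b, (a, b) ∈ P → (b, a) ∉ P

/-- `E` consists of the transitivity clause of `i, j, k` and of literals falsified by `P`. -/
def ExtendsTrans (P : Finset (Fin n × Fin n)) (i j k : Fin n) (E : Clause (EdgeVar n)) : Prop :=
  (Has E j i ∧ Has E k j ∧ Has E i k) ∧
    ∀ a b, Has E a b → (a = j ∧ b = i) ∨ (a = k ∧ b = j) ∨ (a = i ∧ b = k) ∨ (b, a) ∈ P

/-- `D` says that `i` is not minimal among the minimal elements of `P` below `t`, up to literals
falsified by `P`; among these are those for the edges that leave `i` or a minimal element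
from `t` on. -/
structure NotMin (P : Finset (Fin n × Fin n)) (t : ℕ) (i : Fin n) (D : Clause (EdgeVar n)) :
    Prop where
  src : ∀ j, Src P j → (j : ℕ) < t → j ≠ i → Has D j i
  edge : ∀ a b, (a, b) ∈ P → Src P a → a = i ∨ t ≤ (a : ℕ) → Has D b a
  le : ∀ a b, Has D a b → (b, a) ∈ P ∨ (b = i ∧ Src P a ∧ (a : ℕ) < t)

/-- The variables resolved on in the derivation of `NotMin P t i`. -/
def LevelVars (P : Finset (Fin n × Fin n)) (t : ℕ) (a b : Fin n) : Prop :=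
  Free P a b ∧ (Src P a → Src P b → t ≤ (a : ℕ) ∨ t ≤ (b : ℕ))

theorem Free.symm {P : Finset (Fin n × Fin n)} {a b : Fin n} (h : Free P a b) : Free P b a :=
  ⟨h.2, h.1⟩

theorem Asym.irrefl {P : Finset (Fin n × Fin n)} (h : Asym P) (a : Fin n) : (a, a) ∉ P :=
  fun h1 => h a a h1 h1

theorem Asym.ne {P : Finset (Fin n × Fin n)} (h : Asym P) {a b : Fin n} (h1 : (a, b) ∈ P) :
    a ≠ b := by
  rintro rfl
  exact h.irrefl a h1

theorem NotMin.of_not_src {P : Finset (Fin n × Fin n)} {t : ℕ} {i : Fin n}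
    {D : Clause (EdgeVar n)} (h : NotMin P (t + 1) i D)
    (ht : ∀ m : Fin n, (m : ℕ) = t → ¬ Src P m) : NotMin P t i D := by
  have key : ∀ a : Fin n, Src P a → (a : ℕ) ≠ t := fun a ha h1 => ht a h1 ha
  refine ⟨fun j hj hjt => h.src j hj (by omega), fun a b hab ha hat => h.edge a b hab ha ?_,
    fun a b hab => (h.le a b hab).imp_right fun h1 => ⟨h1.1, h1.2.1, ?_⟩⟩
  · have := key a ha
    rcases hat with h1 | h1
    · exact Or.inl h1
    · right; omega
  · have := key a h1.2.1
    omega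

open Classical in
-- For non-minimal `j` choose a minimal `h` with `(h, j) ∈ P`. Resolving `alphaClause i` with
-- $T_{h,j,i}$ replaces $x_{j,i}$ by $x_{h,i}$ and the falsified $x_{j,h}$. Literals $x_{j,i}$ with
-- `(i, j) ∈ P` are already false and are kept, as `NotMin.edge` demands.
theorem exists_base {G Q : Set (Clause (EdgeVar n))} {P : Finset (Fin n × Fin n)} (hP : Asym P)
    (hdom : ∀ b, ¬ Src P b → ∃ a, Src P a ∧ (a, b) ∈ P)
    (hα : ∀ i, alphaClause i ∈ G)
    (hE : ∀ h i j, Src P h → Src P i → h ≠ i → (h, j) ∈ P → (i, j) ∉ P →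
      ∃ E ∈ G, ExtendsTrans P h j i E)
    (i : Fin n) (hi : Src P i) :
    ∃ T, Derives G Q (LevelVars P n) T ∧ NotMin P n i T.conclusion ∧ T.lines ≤ 1 + 2 * n := by
  set J : Finset (Fin n) := Finset.univ.filter fun j => ¬ Src P j ∧ (i, j) ∉ P with hJ
  have hEJ : ∀ j, ∃ E h, j ∈ J → E ∈ G ∧ ExtendsTrans P h j i E ∧ Src P h ∧ h ≠ i ∧ (h, j) ∈ P := by
    intro j
    by_cases hj : j ∈ J
    · simp only [hJ, Finset.mem_filter, Finset.mem_univ, true_and] at hj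
      obtain ⟨h, h1, h2⟩ := hdom j hj.1
      have hhi : h ≠ i := by rintro rfl; exact hj.2 h2
      obtain ⟨E, h3, h4⟩ := hE h i j h1 hi hhi h2 hj.2
      exact ⟨E, h, fun _ => ⟨h3, h4, h1, hhi, h2⟩⟩
    · exact ⟨∅, i, fun h => (hj h).elim⟩
  choose E h hEh using hEJ
  have hJs : ∀ j ∈ J, ¬ Src P j := fun j hj => (Finset.mem_filter.1 hj).2.1
  have hJi : ∀ j ∈ J, (i, j) ∉ P := fun j hj => (Finset.mem_filter.1 hj).2.2
  have hne : ∀ j ∈ J, j ≠ i := by rintro j hj rfl; exact hJs j hj hi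
  have h0 : Derives G Q (fun _ _ => False) (leaf (alphaClause i)) := derives_leaf (Or.inl (hα i))
  obtain ⟨T, h1, -, h3, h4⟩ := exists_chain h0 i E J (fun j hj => Or.inl (hEh j hj).1)
    (fun j hj => has_alphaClause.2 ⟨hne j hj, rfl⟩)
    (fun j hj h => hne j hj (has_alphaClause.1 h).2)
    (fun j hj => (hEh j hj).2.1.1.2.1)
    (fun j hj k hk hh => by
      rcases (hEh j hj).2.1.2 _ _ hh with h | h | h | h
      · exact ((hEh j hj).2.2.2.1 h.2.symm).elim
      · exact hne k hk h.1
      · exact hJs k hk (h.1 ▸ (hEh j hj).2.2.1)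
      · exact hJi k hk h)
    (fun j hj k hk hh => by
      rcases (hEh j hj).2.1.2 _ _ hh with h | h | h | h
      · exact (hne j hj h.1.symm).elim
      · exact h.2
      · exact ((hEh j hj).2.2.2.1 h.1.symm).elim
      · exact (hi _ h).elim)
    (fun j hj => by simp)
  refine ⟨T, h1.mono subset_rfl ?_, ⟨?_, ?_, ?_⟩, ?_⟩
  · rintro a b (h | ⟨rfl, ha⟩ | ⟨rfl, hb⟩)
    · exact h.elim
    · exact ⟨⟨hi _, hJi a ha⟩, fun h => (hJs a ha h).elim⟩
    · exact ⟨⟨hJi b hb, hi _⟩, fun _ h => (hJs b hb h).elim⟩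
  · intro j hj _ hji
    exact (h4 _ _).2 (Or.inl ⟨has_alphaClause.2 ⟨hji, rfl⟩, fun h => hJs j h.1 hj⟩)
  · rintro a b hab ha (rfl | h)
    · exact (h4 _ _).2 (Or.inl ⟨has_alphaClause.2 ⟨(hP.ne hab).symm, rfl⟩,
        fun h => hJi b h.1 hab⟩)
    · exact absurd a.2 (by omega)
  · intro a b hab
    rcases (h4 _ _).1 hab with ⟨h5, h6⟩ | ⟨j, hj, h5, h6⟩
    · obtain ⟨h7, rfl⟩ := has_alphaClause.1 h5
      by_cases ha : Src P a
      · exact Or.inr ⟨rfl, ha, a.2⟩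
      · left
        by_contra hc
        exact h6 ⟨by simp [hJ, ha, hc], rfl⟩
    · rcases (hEh j hj).2.1.2 _ _ h5 with h | h | h | h
      · rw [h.1, h.2]; exact Or.inl (hEh j hj).2.2.2.2
      · exact (h6 h).elim
      · exact Or.inr ⟨h.2, h.1 ▸ (hEh j hj).2.2.1, a.2⟩
      · exact Or.inl h
  · have : J.card ≤ n := by simpa using Finset.card_le_univ J
    rw [h3, lines_leaf]
    omega

open Classical in
-- Elimination of `m`: in the clause for `m`, $T_{j,m,i}$ turns each $x_{j,m}$ into $x_{j,i}\vee
-- x_{i,m}$, and $x_{i,m}$ is then resolved against $x_{m,i}$ in the clause for `i`. The pivots join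
-- `m` to smaller minimal elements, so they were untouched at level `m + 1`.
theorem exists_level {G Q : Set (Clause (EdgeVar n))} {P : Finset (Fin n × Fin n)}
    (hE : ∀ j m i, Src P j → Src P m → Src P i → j ≠ m → m ≠ i → i ≠ j →
      ∃ E ∈ G, ExtendsTrans P j m i E)
    {m i : Fin n} (hm : Src P m) (hi : Src P i) (him : i < m)
    {l r : ProofTree (EdgeVar n)} (hl : Derives G Q (LevelVars P (m + 1)) l)
    (hr : Derives G (after Q l) (LevelVars P (m + 1)) r)
    (hlm : NotMin P (m + 1) m l.conclusion) (hri : NotMin P (m + 1) i r.conclusion) :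
    ∃ T, Derives G Q (LevelVars P m) T ∧ NotMin P m i T.conclusion ∧
      after (after Q l) r ⊆ after Q T ∧ T.lines ≤ l.lines + r.lines + (2 * n + 1) := by
  -- `i` is left out because $x_{i,m}$ is the pivot of the last resolution.
  set J : Finset (Fin n) := Finset.univ.filter fun j => Src P j ∧ j < m ∧ j ≠ i with hJ
  have hJs : ∀ j ∈ J, Src P j := fun j hj => (Finset.mem_filter.1 hj).2.1
  have hJm : ∀ j ∈ J, j < m := fun j hj => (Finset.mem_filter.1 hj).2.2.1
  have hJi : ∀ j ∈ J, j ≠ i := fun j hj => (Finset.mem_filter.1 hj).2.2.2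
  have hEJ : ∀ j, ∃ E, j ∈ J → E ∈ G ∧ ExtendsTrans P j m i E := by
    intro j
    by_cases hj : j ∈ J
    · obtain ⟨E, h1, h2⟩ := hE j m i (hJs j hj) hm hi (hJm j hj).ne him.ne' (hJi j hj).symm
      exact ⟨E, fun _ => ⟨h1, h2⟩⟩
    · exact ⟨∅, fun h => (hj h).elim⟩
  choose E hEh using hEJ
  obtain ⟨T, h1, h2, h3, h4⟩ := exists_chain hl m E J (fun j hj => Or.inl (hEh j hj).1)
    (fun j hj => hlm.src j (hJs j hj) (by have := hJm j hj; omega) (hJm j hj).ne)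
    (fun j hj h => by
      rcases hlm.le _ _ h with h | h
      · exact hm _ h
      · exact (hJm j hj).ne h.1)
    (fun j hj => (hEh j hj).2.1.1)
    (fun j hj k hk hh => by
      rcases (hEh j hj).2.2 _ _ hh with h | h | h | h
      · exact (hJm j hj).ne h.2.symm
      · exact hJi k hk h.1
      · exact him.ne h.2.symm
      · exact hJs k hk _ h)
    (fun j hj k hk hh => by
      rcases (hEh j hj).2.2 _ _ hh with h | h | h | h
      · exact h.2
      · exact (him.ne h.1.symm).elim
      · exact ((hJm j hj).ne h.1.symm).elim
      · exact (hm _ h).elim)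
    (fun j hj h => by
      have h1 := h.1.2 (hJs j hj) hm
      have := hJm j hj
      omega)
  have hl1 : Has T.conclusion i m := (h4 _ _).2 (Or.inl
    ⟨hlm.src i hi (by omega) him.ne, fun h => hJi i h.1 rfl⟩)
  have hl2 : ∀ c d, Has T.conclusion c d → (d, c) ∈ P ∨ (c = i ∧ d = m) ∨
      (d = i ∧ Src P c ∧ (c : ℕ) < m) := by
    intro c d h
    rcases (h4 _ _).1 h with ⟨h5, h6⟩ | ⟨j, hj, h5, h6⟩
    · rcases hlm.le _ _ h5 with h7 | ⟨rfl, h7, h8⟩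
      · exact Or.inl h7
      · by_cases hci : c = i
        · exact Or.inr (Or.inl ⟨hci, rfl⟩)
        · have hcm : c ≠ d := h5.ne
          exact (h6 ⟨by simp only [hJ, Finset.mem_filter, Finset.mem_univ, true_and]
                        exact ⟨h7, by omega, hci⟩, rfl⟩).elim
    · rcases (hEh j hj).2.2 _ _ h5 with h | h | h | h
      · exact (h6 h).elim
      · exact Or.inr (Or.inl h)
      · exact Or.inr (Or.inr ⟨h.2, h.1 ▸ hJs j hj, h.1 ▸ hJm j hj⟩)
      · exact Or.inl h
  obtain ⟨C, hC, hC'⟩ := exists_resolvent (A := T.conclusion) (B := r.conclusion) him.ne hl1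
    (fun h => by
      rcases hl2 _ _ h with h | h | h
      · exact hm _ h
      · exact him.ne h.2
      · exact absurd h.2.2 (lt_irrefl _))
    (hri.src m hm (by omega) him.ne')
    (fun h => by
      rcases hri.le _ _ h with h | h
      · exact hi _ h
      · exact him.ne h.1.symm)
  refine ⟨node C (lit i m him.ne) T r, derives_node (U := fun a b => LevelVars P (m + 1) a b ∨
      (b = m ∧ a ∈ J) ∨ (a = m ∧ b ∈ J)) him.ne h1 (hr.mono h2 fun a b h => Or.inl h) hC
      ?_ ?_ ?_ ?_, ⟨?_, ?_, ?_⟩, ?_, ?_⟩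
  · rintro a b (h | ⟨rfl, h⟩ | ⟨rfl, h⟩)
    · exact ⟨h.1, fun ha hb => (h.2 ha hb).imp (by omega) (by omega)⟩
    · exact ⟨⟨hm _, hJs a h _⟩, fun _ _ => Or.inr le_rfl⟩
    · exact ⟨⟨hJs b h _, hm _⟩, fun _ _ => Or.inl le_rfl⟩
  · exact ⟨⟨hm _, hi _⟩, fun _ _ => Or.inr le_rfl⟩
  · exact ⟨⟨hi _, hm _⟩, fun _ _ => Or.inl le_rfl⟩
  · rintro ⟨h | ⟨-, h⟩ | ⟨h, -⟩, -⟩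
    · have := h.2 hi hm
      omega
    · exact hJi i h rfl
    · exact him.ne h
  · intro j hj hjm hji
    refine (hC' _ _).2 (Or.inr ⟨hri.src j hj (by omega) hji, ?_⟩)
    rintro ⟨rfl, -⟩
    exact absurd hjm (lt_irrefl _)
  · intro a b hab ha hai
    have key : a = m ∨ (a = i ∨ (m : ℕ) + 1 ≤ a) := by
      rcases hai with h | h
      · exact Or.inr (Or.inl h)
      · rcases h.eq_or_lt with h | h
        · exact Or.inl (Fin.ext h.symm)
        · exact Or.inr (Or.inr h)
    rcases key with rfl | h
    · refine (hC' _ _).2 (Or.inl ⟨(h4 _ _).2 (Or.inl ⟨hlm.edge a b hab ha (Or.inl rfl), ?_⟩), ?_⟩)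
      · exact fun h => hJs b h.1 _ hab
      · rintro ⟨rfl, -⟩
        exact hi _ hab
    · refine (hC' _ _).2 (Or.inr ⟨hri.edge a b hab ha h, ?_⟩)
      rintro ⟨rfl, rfl⟩
      exact hm _ hab
  · intro a b hab
    rcases (hC' _ _).1 hab with ⟨h, h'⟩ | ⟨h, h'⟩
    · rcases hl2 _ _ h with h | h | h
      · exact Or.inl h
      · exact (h' h).elim
      · exact Or.inr h
    · rcases hri.le _ _ h with h | ⟨rfl, h5, h6⟩
      · exact Or.inl h
      · refine Or.inr ⟨rfl, h5, ?_⟩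
        have : a ≠ m := fun h => h' ⟨h, rfl⟩
        have : (a : ℕ) ≠ m := fun h => this (Fin.ext h)
        omega
  · exact (Set.union_subset_union_left _ h2).trans (after_node C _ T r)
  · have : J.card ≤ n := by simpa using Finset.card_le_univ J
    rw [lines_node, h3]
    omega

open Classical in
-- A memoised recursion: `S` records the pairs `(t, i)` already derived, and a repeated request is a
-- single leaf. A new pair is charged `2 * n + 3` lines: `2 * n + 1` for `exists_level` and one for
-- each of its two requests. New pairs have level at least `t`, so the requests at level `m + 1`
-- cannot enter `(m, i)`, and the charge is made only once.
theorem exists_notMin {G : Set (Clause (EdgeVar n))} {P : Finset (Fin n × Fin n)} (hP : Asym P)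
    (hdom : ∀ b, ¬ Src P b → ∃ a, Src P a ∧ (a, b) ∈ P)
    (hα : ∀ i, alphaClause i ∈ G)
    (hE : ∀ h i j, Src P h → Src P i → h ≠ i → (h, j) ∈ P → (i, j) ∉ P →
      ∃ E ∈ G, ExtendsTrans P h j i E)
    (hE' : ∀ j m i, Src P j → Src P m → Src P i → j ≠ m → m ≠ i → i ≠ j →
      ∃ E ∈ G, ExtendsTrans P j m i E) (d : ℕ) :
    ∀ t, t + d = n → ∀ (Q : Set (Clause (EdgeVar n))) (S : Finset (ℕ × Fin n)),
      (∀ p ∈ S, ∃ D ∈ Q, NotMin P p.1 p.2 D) → S ⊆ Finset.range (n + 1) ×ˢ Finset.univ →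
      ∀ i : Fin n, Src P i → (i : ℕ) < t → ∃ (T : ProofTree (EdgeVar n)) (S' : Finset (ℕ × Fin n)),
        Derives G Q (LevelVars P t) T ∧ NotMin P t i T.conclusion ∧ S ⊆ S' ∧
        (∀ p ∈ S', p ∉ S → t ≤ p.1) ∧ (∀ p ∈ S', ∃ D ∈ after Q T, NotMin P p.1 p.2 D) ∧
        S' ⊆ Finset.range (n + 1) ×ˢ Finset.univ ∧
        T.lines + (2 * n + 3) * S.card ≤ 1 + (2 * n + 3) * S'.card := by
  induction d with
  | zero =>
    intro t ht Q S hS hS' i hi hit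
    obtain rfl : t = n := by omega
    by_cases hm : (t, i) ∈ S
    · obtain ⟨D, hD, hD'⟩ := hS _ hm
      exact ⟨leaf D, S, derives_leaf (Or.inr hD), hD', subset_rfl, fun p h h' => (h' h).elim,
        fun p hp => (hS p hp).imp fun D h => ⟨Or.inl h.1, h.2⟩, hS', by simp⟩
    · obtain ⟨T, h1, h2, h3⟩ := exists_base (Q := Q) hP hdom hα hE i hi
      refine ⟨T, insert (t, i) S, h1, h2, Finset.subset_insert _ _, ?_, ?_, ?_, ?_⟩
      · rintro p hp hp'
        rcases Finset.mem_insert.1 hp with rfl | hp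
        · exact le_rfl
        · exact (hp' hp).elim
      · rintro p hp
        rcases Finset.mem_insert.1 hp with rfl | hp
        · exact ⟨_, conclusion_mem_after T, h2⟩
        · exact (hS p hp).imp fun D h => ⟨Or.inl h.1, h.2⟩
      · exact Finset.insert_subset (by simp) hS'
      · rw [Finset.card_insert_of_notMem hm, mul_add]
        omega
  | succ d ih =>
    intro t ht Q S hS hS' i hi hit
    by_cases hmem : (t, i) ∈ S
    · obtain ⟨D, hD, hD'⟩ := hS _ hmem
      exact ⟨leaf D, S, derives_leaf (Or.inr hD), hD', subset_rfl, fun p h h' => (h' h).elim,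
        fun p hp => (hS p hp).imp fun D h => ⟨Or.inl h.1, h.2⟩, hS', by simp⟩
    obtain ⟨m, rfl⟩ : ∃ m : Fin n, (m : ℕ) = t := ⟨⟨t, by omega⟩, rfl⟩
    by_cases hm : Src P m
    · obtain ⟨l, S1, hl1, hl2, hl3, hl4, hl5, hl6, hl7⟩ :=
        ih (m + 1) (by omega) Q S hS hS' m hm (by omega)
      obtain ⟨r, S2, hr1, hr2, hr3, hr4, hr5, hr6, hr7⟩ :=
        ih (m + 1) (by omega) (after Q l) S1 hl5 hl6 i hi (by omega)
      obtain ⟨T, h1, h2, h3, h4⟩ := exists_level hE' hm hi hit hl1 hr1 hl2 hr2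
      have hnot : ((m : ℕ), i) ∉ S2 := by
        intro h
        by_cases h' : ((m : ℕ), i) ∈ S1
        · have := hl4 _ h' hmem
          simp at this
        · have := hr4 _ h h'
          simp at this
      refine ⟨T, insert ((m : ℕ), i) S2, h1, h2,
        (hl3.trans hr3).trans (Finset.subset_insert _ _), ?_, ?_, ?_, ?_⟩
      · rintro p hp hp'
        rcases Finset.mem_insert.1 hp with rfl | hp
        · exact le_rfl
        · by_cases h' : p ∈ S1
          · have := hl4 _ h' hp'
            omega
          · have := hr4 _ hp h'
            omega
      · rintro p hp
        rcases Finset.mem_insert.1 hp with rfl | hp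
        · exact ⟨_, conclusion_mem_after T, h2⟩
        · exact (hr5 p hp).imp fun D h => ⟨h3 h.1, h.2⟩
      · exact Finset.insert_subset (by simp) hr6
      · rw [Finset.card_insert_of_notMem hnot, mul_add]
        omega
    · obtain ⟨T, S1, h1, h2, h3, h4, h5, h6, h7⟩ :=
        ih (m + 1) (by omega) Q S hS hS' i hi (by omega)
      refine ⟨T, S1, h1.mono subset_rfl fun a b h => ⟨h.1, fun ha hb => (h.2 ha hb).imp
        (by omega) (by omega)⟩, h2.of_not_src ?_, h3, fun p hp hp' => ?_, h5, h6, h7⟩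
      · rintro m' hm'
        rwa [Fin.ext hm']
      · have := h4 p hp hp'
        omega

/-- The conclusion of a derivation below `P`: it is falsified by `P`, and mentions all the edges
of `P` that leave a minimal element. -/
structure Covers (P : Finset (Fin n × Fin n)) (D : Clause (EdgeVar n)) : Prop where
  edge : ∀ a b, (a, b) ∈ P → Src P a → Has D b a
  le : ∀ a b, Has D a b → (b, a) ∈ P

theorem exists_covers_of_avail {G : Set (Clause (EdgeVar n))} {P : Finset (Fin n × Fin n)}
    (hn : 1 ≤ n) (hP : Asym P)
    (hdom : ∀ b, ¬ Src P b → ∃ a, Src P a ∧ (a, b) ∈ P)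
    (hα : ∀ i, alphaClause i ∈ G)
    (hE : ∀ h i j, Src P h → Src P i → h ≠ i → (h, j) ∈ P → (i, j) ∉ P →
      ∃ E ∈ G, ExtendsTrans P h j i E)
    (hE' : ∀ j m i, Src P j → Src P m → Src P i → j ≠ m → m ≠ i → i ≠ j →
      ∃ E ∈ G, ExtendsTrans P j m i E) :
    ∃ T, Derives G ∅ (Free P) T ∧ Covers P T.conclusion ∧ T.lines ≤ 11 * n ^ 3 := by
  classical
  obtain ⟨i, hi, hmin⟩ : ∃ i, Src P i ∧ ∀ j, Src P j → i ≤ j := by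
    have hex : ∃ i, Src P i := by
      by_contra! h
      obtain ⟨a, ha, -⟩ := hdom ⟨0, hn⟩ (h _)
      exact h a ha
    obtain ⟨i, hi, h⟩ := WellFounded.has_min (wellFounded_lt (α := Fin n)) {i | Src P i} hex
    exact ⟨i, hi, fun j hj => not_lt.1 (h j hj)⟩
  -- No minimal element other than `i` lies below `i + 1`, so at this level only literals falsified
  -- by `P` remain.
  obtain ⟨T, S, h1, h2, -, -, -, h6, h7⟩ := exists_notMin hP hdom hα hE hE' (n - (i + 1)) (i + 1)
    (by omega) ∅ ∅ (by simp) (by simp) i hi (by omega)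
  refine ⟨T, h1.mono subset_rfl fun a b h => h.1, ⟨fun a b hab ha => h2.edge a b hab ha ?_,
    fun a b hab => ?_⟩, ?_⟩
  · have := hmin a ha
    rcases this.eq_or_lt with h | h
    · exact Or.inl h.symm
    · right; omega
  · rcases h2.le a b hab with h | ⟨rfl, h, h'⟩
    · exact h
    · have := hmin a h
      exact (hab.ne (by omega)).elim
  · have hS := Finset.card_le_card h6
    simp only [Finset.card_product, Finset.card_range, Finset.card_univ, Fintype.card_fin] at hS
    simp only [Finset.card_empty, mul_zero, add_zero] at h7
    calc T.lines ≤ 1 + (2 * n + 3) * S.card := h7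
      _ ≤ 1 * n ^ 3 + (2 * n + 3 * n) * ((n + n) * n) := by
        gcongr
        · nlinarith [Nat.one_le_pow 3 n hn]
        · nlinarith
        · exact hS.trans (by gcongr)
      _ = 11 * n ^ 3 := by ring

/-! ### Learning the transitivity clauses -/

/-- `D` has the same literals as the transitivity clause of `i, j, k`. -/
def IsTrans (i j k : Fin n) (D : Clause (EdgeVar n)) : Prop :=
  ∀ a b, Has D a b ↔ (a = j ∧ b = i) ∨ (a = k ∧ b = j) ∨ (a = i ∧ b = k)

theorem IsTrans.extendsTrans {i j k : Fin n} {D : Clause (EdgeVar n)} (h : IsTrans i j k D)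
    (P : Finset (Fin n × Fin n)) : ExtendsTrans P i j k D := by
  refine ⟨⟨(h _ _).2 ?_, (h _ _).2 ?_, (h _ _).2 ?_⟩, fun a b hab => ?_⟩
  · simp
  · simp
  · simp
  · have := (h a b).1 hab
    tauto

open Classical in
/-- The triples whose transitivity clause is not known. -/
noncomputable def unknown (Q : Set (Clause (EdgeVar n))) : Finset (Fin n × Fin n × Fin n) :=
  Finset.univ.filter fun p => ¬ ∃ D ∈ Q, IsTrans p.1 p.2.1 p.2.2 D

theorem mem_unknown {Q : Set (Clause (EdgeVar n))} {i j k : Fin n} :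
    (i, j, k) ∈ unknown Q ↔ ¬ ∃ D ∈ Q, IsTrans i j k D := by
  simp [unknown]

theorem unknown_anti {Q Q' : Set (Clause (EdgeVar n))} (h : Q ⊆ Q') : unknown Q' ⊆ unknown Q := by
  rintro ⟨i, j, k⟩ hp
  rw [mem_unknown] at hp ⊢
  exact fun ⟨D, hD, hD'⟩ => hp ⟨D, h hD, hD'⟩

theorem card_unknown_after_le (Q : Set (Clause (EdgeVar n))) (T : ProofTree (EdgeVar n)) :
    (unknown (after Q T)).card ≤ (unknown Q).card :=
  Finset.card_le_card (unknown_anti Set.subset_union_left)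

theorem card_unknown_le (Q : Set (Clause (EdgeVar n))) : (unknown Q).card ≤ n ^ 3 := by
  refine (Finset.card_le_univ _).trans_eq ?_
  simp only [Fintype.card_prod, Fintype.card_fin]
  ring

variable {r s : Fin n → Fin n → Fin n → Fin n}

theorem IsGuard.not_mem (hg : IsGuard r s) {i j k : Fin n} (hij : i ≠ j) (hjk : j ≠ k)
    (hki : k ≠ i) (h : (r i j k = i ∨ r i j k = j ∨ r i j k = k) ∧
      (s i j k = i ∨ s i j k = j ∨ s i j k = k)) : False := by
  refine (hg i j k hij hjk hki).2 ?_
  rintro x (rfl | rfl)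
  · exact h.1
  · exact h.2

/-- `P'` adds only edges of the triangle to `P`, and a guard pair is never contained in the
triangle, so the guard variable is still free and may be resolved on. -/
theorem exists_learn (hg : IsGuard r s) {i j k : Fin n} (hij : i ≠ j) (hjk : j ≠ k)
    (hki : k ≠ i) {Q : Set (Clause (EdgeVar n))} {P P' : Finset (Fin n × Fin n)}
    (hQ : (i, j, k) ∈ unknown Q) (hf : Free P (r i j k) (s i j k))
    (hP : ∀ a b, (a, b) ∈ P' → (a, b) ∈ P ∨
      ((a = i ∨ a = j ∨ a = k) ∧ (b = i ∨ b = j ∨ b = k))) :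
    ∃ T, Derives (GGT n r s) Q (Free P') T ∧ IsTrans i j k T.conclusion ∧ T.lines = 3 ∧
      (unknown (after Q T)).card + 1 ≤ (unknown Q).card := by
  have hrs := (hg i j k hij hjk hki).1
  have hno := hg.not_mem hij hjk hki
  set A := insert (lit (r i j k) (s i j k) hrs) (transClause i j k hij hjk hki) with hA
  set B := insert (lit (s i j k) (r i j k) hrs.symm) (transClause i j k hij hjk hki) with hB
  have hA' : A ∈ GGT n r s := Or.inr ⟨i, j, k, hij, hjk, hki, hrs, Or.inl rfl⟩
  have hB' : B ∈ GGT n r s :=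
    Or.inr ⟨i, j, k, hij, hjk, hki, hrs, Or.inr (by rw [hB, lit_neg])⟩
  have hAh : ∀ a b, Has A a b ↔ _ := fun a b => has_insert_lit hrs
  have hBh : ∀ a b, Has B a b ↔ _ := fun a b => has_insert_lit hrs.symm
  simp only [has_transClause] at hAh hBh
  obtain ⟨C, hC, hC'⟩ := exists_resolvent (A := A) (B := B) hrs ((hAh _ _).2 (by simp))
    (fun h => by
      rcases (hAh _ _).1 h with h | h
      · exact hrs h.2
      · exact hno (by tauto))
    ((hBh _ _).2 (by simp))
    (fun h => by
      rcases (hBh _ _).1 h with h | h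
      · exact hrs h.1
      · exact hno (by tauto))
  have hCt : IsTrans i j k C := by
    intro a b
    rw [hC', hAh, hBh]
    constructor
    · tauto
    · intro h
      refine Or.inl ⟨Or.inr h, ?_⟩
      rintro ⟨rfl, rfl⟩
      exact hno (by tauto)
  have hf' : Free P' (r i j k) (s i j k) := by
    constructor
    · intro h
      rcases hP _ _ h with h | h
      · exact hf.1 h
      · exact hno h
    · intro h
      rcases hP _ _ h with h | h
      · exact hf.2 h
      · exact hno h.symm
  refine ⟨node C (lit (r i j k) (s i j k) hrs) (leaf A) (leaf B),
    derives_node (U := fun _ _ => False) hrs (derives_leaf (Or.inl hA'))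
      (derives_leaf (Or.inl hB')) hC (fun _ _ h => h.elim) hf' hf'.symm (fun h => h.1),
    hCt, rfl, ?_⟩
  refine Finset.card_lt_card ((Finset.ssubset_iff_of_subset
    (unknown_anti Set.subset_union_left)).2 ⟨_, hQ, ?_⟩)
  rw [mem_unknown, not_not]
  exact ⟨C, conclusion_mem_after (node C (lit (r i j k) (s i j k) hrs) (leaf A) (leaf B)), hCt⟩

/-- The dichotomy that drives the search: a clause that cannot be used below `P` can be learned
there. -/
theorem avail_or_free (hg : IsGuard r s) {i j k : Fin n} (hij : i ≠ j) (hjk : j ≠ k)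
    (hki : k ≠ i) (Q : Set (Clause (EdgeVar n))) (P : Finset (Fin n × Fin n)) :
    (∃ E ∈ GGT n r s ∪ Q, ExtendsTrans P i j k E) ∨
      ((i, j, k) ∈ unknown Q ∧ Free P (r i j k) (s i j k)) := by
  have hrs := (hg i j k hij hjk hki).1
  by_cases hQ : (i, j, k) ∈ unknown Q
  swap
  · rw [mem_unknown, not_not] at hQ
    obtain ⟨D, hD, hD'⟩ := hQ
    exact Or.inl ⟨D, Or.inr hD, hD'.extendsTrans P⟩
  have key : ∀ (a b : Fin n) (hab : a ≠ b), (b, a) ∈ P →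
      ExtendsTrans P i j k (insert (lit a b hab) (transClause i j k hij hjk hki)) := by
    intro a b hab hP
    unfold ExtendsTrans
    simp only [has_insert_lit, has_transClause]
    refine ⟨by simp, ?_⟩
    rintro c d (⟨rfl, rfl⟩ | h)
    · exact Or.inr (Or.inr (Or.inr hP))
    · tauto
  by_cases h1 : (r i j k, s i j k) ∈ P
  · refine Or.inl ⟨_, Or.inl ?_, key _ _ hrs.symm h1⟩
    exact Or.inr ⟨i, j, k, hij, hjk, hki, hrs, Or.inr (by rw [lit_neg])⟩
  by_cases h2 : (s i j k, r i j k) ∈ P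
  · refine Or.inl ⟨_, Or.inl ?_, key _ _ hrs h2⟩
    exact Or.inr ⟨i, j, k, hij, hjk, hki, hrs, Or.inl rfl⟩
  exact Or.inr ⟨hQ, h1, h2⟩

/-! ### Partial orders on the paths of the refutation -/

theorem src_insert {P : Finset (Fin n × Fin n)} {a b c : Fin n} :
    Src (insert (a, b) P) c ↔ Src P c ∧ c ≠ b := by
  unfold Src
  simp only [Finset.mem_insert, Prod.mk.injEq, not_or, not_and]
  constructor
  · exact fun h => ⟨fun d => (h d).2, (h a).1 rfl⟩
  · exact fun h d => ⟨fun _ => h.2, h.1 d⟩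

theorem Asym.insert {P : Finset (Fin n × Fin n)} (hP : Asym P) {a b : Fin n} (hab : a ≠ b)
    (h : (b, a) ∉ P) : Asym (insert (a, b) P) := by
  intro c d hcd hdc
  simp only [Finset.mem_insert, Prod.mk.injEq] at hcd hdc
  rcases hcd with ⟨rfl, rfl⟩ | hcd
  · rcases hdc with ⟨rfl, -⟩ | hdc
    · exact hab rfl
    · exact h hdc
  · rcases hdc with ⟨rfl, rfl⟩ | hdc
    · exact h hcd
    · exact hP _ _ hcd hdc

/-- `P` sets no variable in two ways, and every element that is not minimal can be reached from a
minimal one in at most two steps. -/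
structure Reach (P : Finset (Fin n × Fin n)) : Prop where
  asym : Asym P
  reach : ∀ b, ¬ Src P b → ∃ a, (a, b) ∈ P ∧ (Src P a ∨ ∃ h, Src P h ∧ (h, a) ∈ P)

/-- All elements that lose minimality become successors of one surviving minimal `j`, so anything
they dominated is two steps from `j`. -/
theorem Reach.of_dominated {P P' : Finset (Fin n × Fin n)}
    (hdom : ∀ b, ¬ Src P b → ∃ a, Src P a ∧ (a, b) ∈ P) (hsub : P ⊆ P') (hP' : Asym P')
    (j : Fin n) (hj : Src P' j) (h : ∀ x, Src P x → ¬ Src P' x → (j, x) ∈ P') : Reach P' := by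
  refine ⟨hP', fun b hb => ?_⟩
  by_cases hb' : Src P b
  · exact ⟨j, h b hb' hb, Or.inl hj⟩
  · obtain ⟨a, ha, hab⟩ := hdom b hb'
    refine ⟨a, hsub hab, ?_⟩
    by_cases ha' : Src P' a
    · exact Or.inl ha'
    · exact Or.inr ⟨j, hj, h a ha ha'⟩

open Classical in
/-- The elements that are not minimal and have no minimal predecessor. -/
noncomputable def undominated (P : Finset (Fin n × Fin n)) : Finset (Fin n) :=
  Finset.univ.filter fun b => ¬ Src P b ∧ ∀ a, Src P a → (a, b) ∉ P

theorem mem_undominated {P : Finset (Fin n × Fin n)} {b : Fin n} :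
    b ∈ undominated P ↔ ¬ Src P b ∧ ∀ a, Src P a → (a, b) ∉ P := by
  simp [undominated]

theorem card_undominated_le (P : Finset (Fin n × Fin n)) : (undominated P).card ≤ n := by
  simpa using Finset.card_le_univ (undominated P)

/-! ### Branching and the recursion over partial assignments -/

/-- Branching on a variable that is not set by `P`. -/
theorem exists_branch {F Q : Set (Clause (EdgeVar n))} {P : Finset (Fin n × Fin n)} {a b : Fin n}
    (hab : a ≠ b) (hf : Free P a b) {l r : ProofTree (EdgeVar n)}
    (hl : Derives F Q (Free (insert (b, a) P)) l)
    (hr : Derives F (after Q l) (Free (insert (a, b) P)) r)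
    (hll : ∀ c d, Has l.conclusion c d → (d, c) ∈ insert (b, a) P)
    (hrr : ∀ c d, Has r.conclusion c d → (d, c) ∈ insert (a, b) P)
    (hla : Has l.conclusion a b) (hrb : Has r.conclusion b a) :
    ∃ T, Derives F Q (Free P) T ∧ (∀ c d, Has T.conclusion c d → (d, c) ∈ P) ∧
      (∀ c d, Has l.conclusion c d → ¬ (c = a ∧ d = b) → Has T.conclusion c d) ∧
      (∀ c d, Has r.conclusion c d → ¬ (c = b ∧ d = a) → Has T.conclusion c d) ∧
      T.lines = l.lines + r.lines + 1 ∧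
      (unknown (after Q T)).card ≤ (unknown (after (after Q l) r)).card := by
  obtain ⟨C, hC, hC'⟩ := exists_resolvent hab hla
    (fun h => by
      rcases Finset.mem_insert.1 (hll _ _ h) with h | h
      · exact hab (Prod.mk.inj h).1
      · exact hf.1 h)
    hrb
    (fun h => by
      rcases Finset.mem_insert.1 (hrr _ _ h) with h | h
      · exact hab (Prod.mk.inj h).2
      · exact hf.2 h)
  refine ⟨node C (lit a b hab) l r, derives_node (U := fun c d => Free P c d ∧
    ¬ (c = a ∧ d = b) ∧ ¬ (c = b ∧ d = a)) hab (hl.mono subset_rfl ?_) (hr.mono subset_rfl ?_) hC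
    (fun c d h => h.1) hf hf.symm (fun h => h.1.2.1 ⟨rfl, rfl⟩), ?_, ?_, ?_, lines_node _ _ _ _,
    Finset.card_le_card (unknown_anti (after_node _ _ _ _))⟩
  · intro c d h
    simp only [Free, Finset.mem_insert, Prod.mk.injEq] at h ⊢
    tauto
  · intro c d h
    simp only [Free, Finset.mem_insert, Prod.mk.injEq] at h ⊢
    tauto
  · intro c d h
    rcases (hC' c d).1 h with ⟨h, h'⟩ | ⟨h, h'⟩
    · have := hll _ _ h
      simp only [Finset.mem_insert, Prod.mk.injEq] at this
      tauto
    · have := hrr _ _ h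
      simp only [Finset.mem_insert, Prod.mk.injEq] at this
      tauto
  · exact fun c d h h' => (hC' c d).2 (Or.inl ⟨h, h'⟩)
  · exact fun c d h h' => (hC' c d).2 (Or.inr ⟨h, h'⟩)

/-- Below `P`, and with the clauses `Q` known, there is a derivation whose number of lines is
bounded in terms of the number of transitivity clauses that become known in it. -/
def Solvable (F : Set (Clause (EdgeVar n))) (K c : ℕ) (Q : Set (Clause (EdgeVar n)))
    (P : Finset (Fin n × Fin n)) : Prop :=
  ∃ T, Derives F Q (Free P) T ∧ Covers P T.conclusion ∧
    T.lines + c * (unknown (after Q T)).card ≤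
      K + 4 * (undominated P).card + c * (unknown Q).card

/-- With `h` minimal and edges from `h` to `a` and from `a` to `b`, branch on $x_{h,b}$. The edge
from `b` to `h` closes a cycle and falsifies $T_{h,a,b}$; the edge from `h` to `b` makes `b`
dominated. As `b` was not minimal, the latter leaves the minimal elements unchanged. -/
theorem solvable_of_undominated (hg : IsGuard r s) {K c : ℕ} {Q : Set (Clause (EdgeVar n))}
    {P : Finset (Fin n × Fin n)} (hP : Reach P)
    (ih : ∀ P', P ⊂ P' → Reach P' → ∀ Q, Solvable (GGT n r s) K c Q P')
    {b : Fin n} (hb : b ∈ undominated P) : Solvable (GGT n r s) K c Q P := by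
  obtain ⟨hb1, hb2⟩ := mem_undominated.1 hb
  obtain ⟨a, hab, ha⟩ := hP.reach b hb1
  obtain ⟨h, hh, hha⟩ : ∃ h, Src P h ∧ (h, a) ∈ P := by
    rcases ha with ha | ha
    · exact (hb2 a ha hab).elim
    · exact ha
  have hhb : h ≠ b := by rintro rfl; exact hb1 hh
  have hhb' : (h, b) ∉ P := hb2 h hh
  have hab' := hP.asym.ne hab
  have hha' := hP.asym.ne hha
  have hsrc : ∀ x, Src (insert (h, b) P) x ↔ Src P x := fun x => by
    rw [src_insert, and_iff_left_iff_imp]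
    rintro hx rfl
    exact hb1 hx
  obtain ⟨l, hl, hlt, hl3⟩ : ∃ l, Derives (GGT n r s) Q (Free (insert (b, h) P)) l ∧
      ExtendsTrans P h a b l.conclusion ∧ l.lines ≤ 3 := by
    rcases avail_or_free hg hha' hab' hhb.symm Q P with ⟨E, hE, hE'⟩ | ⟨h1, h2⟩
    · exact ⟨leaf E, derives_leaf hE, hE', by simp⟩
    · obtain ⟨T, h3, h4, h5, -⟩ := exists_learn hg hha' hab' hhb.symm
        (P' := insert (b, h) P) h1 h2 (by
          simp only [Finset.mem_insert, Prod.mk.injEq]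
          rintro c d (⟨rfl, rfl⟩ | h)
          · simp
          · exact Or.inl h)
      exact ⟨T, h3, h4.extendsTrans P, h5.le⟩
  obtain ⟨R, hR, hRc, hRl⟩ := ih (insert (h, b) P) (Finset.ssubset_insert hhb')
    ⟨hP.asym.insert hhb (hh b), fun x hx => by
      simp only [hsrc, Finset.mem_insert] at hx ⊢
      obtain ⟨y, h1, h2⟩ := hP.reach x hx
      refine ⟨y, Or.inr h1, h2.imp_right ?_⟩
      rintro ⟨z, h3, h4⟩
      exact ⟨z, h3, Or.inr h4⟩⟩ (after Q l)
  obtain ⟨T, h1, h2, -, h4, h5, h6⟩ := exists_branch hhb ⟨hhb', hh b⟩ hl hR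
    (fun c d hcd => by
      rcases hlt.2 c d hcd with ⟨rfl, rfl⟩ | ⟨rfl, rfl⟩ | ⟨rfl, rfl⟩ | h
      · exact Finset.mem_insert_of_mem hha
      · exact Finset.mem_insert_of_mem hab
      · exact Finset.mem_insert_self _ _
      · exact Finset.mem_insert_of_mem h)
    hRc.le hlt.1.2.2 (hRc.edge _ _ (Finset.mem_insert_self _ _) ((hsrc h).2 hh))
  refine ⟨T, h1, ⟨fun x y hxy hx => h4 _ _ (hRc.edge _ _ (Finset.mem_insert_of_mem hxy)
    ((hsrc x).2 hx)) ?_, h2⟩, ?_⟩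
  · rintro ⟨rfl, rfl⟩
    exact hhb' hxy
  -- The loss of one undominated element pays for four lines: at most three in `l`, and the
  -- branching node.
  · have hlt : (undominated (insert (h, b) P)).card < (undominated P).card := by
      refine Finset.card_lt_card ((Finset.ssubset_iff_of_subset ?_).2 ⟨b, hb, ?_⟩)
      · intro x hx
        simp only [mem_undominated, hsrc, Finset.mem_insert, not_or] at hx ⊢
        exact ⟨hx.1, fun y hy => (hx.2 y hy).2⟩
      · rw [mem_undominated]
        exact fun h' => h'.2 h ((hsrc h).2 hh) (Finset.mem_insert_self _ _)
    have h7 := Nat.mul_le_mul_left c h6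
    have h8 := Nat.mul_le_mul_left c (card_unknown_after_le Q l)
    omega

/-- Setting the cycle `j`, `m`, `i` edge by edge leaves three side branches, each costing at most `K
+ 4 * n` besides what its own learning pays for. With three branching nodes and three lines of
learning this exceeds `K` by `2 * K + 12 * n + 6`, which the newly learned triple must cover. -/
theorem solvable_of_unknown_src (hg : IsGuard r s) {K c : ℕ} (hc : 2 * K + 12 * n + 6 ≤ c)
    {Q : Set (Clause (EdgeVar n))} {P : Finset (Fin n × Fin n)} (hP : Asym P)
    (hdom : ∀ b, ¬ Src P b → ∃ a, Src P a ∧ (a, b) ∈ P)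
    (ih : ∀ P', P ⊂ P' → Reach P' → ∀ Q, Solvable (GGT n r s) K c Q P')
    {j m i : Fin n} (hj : Src P j) (hm : Src P m) (hi : Src P i) (hjm : j ≠ m) (hmi : m ≠ i)
    (hij : i ≠ j) (hQ : (j, m, i) ∈ unknown Q) (hf : Free P (r j m i) (s j m i)) :
    Solvable (GGT n r s) K c Q P := by
  set P2 := insert (j, m) P with hP2
  set P3 := insert (m, i) P2 with hP3
  have hP2a : Asym P2 := hP.insert hjm (hj m)
  have hP3a : Asym P3 := hP2a.insert hmi (by simp [hP2, hm i, hij])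
  have hs2 : P ⊆ P2 := Finset.subset_insert _ _
  have hs3 : P ⊆ P3 := hs2.trans (Finset.subset_insert _ _)
  have hmiP2 : Free P2 i m := by simp [Free, hP2, hm i, hi m, hij, hjm.symm]
  have hijP3 : Free P3 j i := by simp [Free, hP3, hP2, hj i, hi j, hij, hjm, hmi.symm, hij.symm]
  obtain ⟨T0, h01, h02, h03, h04⟩ := exists_learn hg hjm hmi hij (P' := insert (i, j) P3) hQ hf (by
    simp only [hP3, hP2, Finset.mem_insert, Prod.mk.injEq]
    clear * -
    tauto)
  obtain ⟨Tb, hb1, hb2, hb3⟩ := ih (insert (j, i) P3)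
    (hs3.trans_ssubset (Finset.ssubset_insert hijP3.1))
    (Reach.of_dominated hdom (hs3.trans (Finset.subset_insert _ _))
      (hP3a.insert hij.symm hijP3.2) j
      (by simp [hP3, hP2, src_insert, hj, hij.symm, hjm])
      (fun x hx hx' => by
        simp only [hP3, hP2, src_insert, Finset.mem_insert, Prod.mk.injEq] at hx' ⊢
        clear * - hx hx'
        tauto)) (after Q T0)
  obtain ⟨N1, h11, h12, h13, h14, h15, h16⟩ := exists_branch hij.symm hijP3 h01 hb1
    (fun a b hab => by
      simp only [hP3, hP2, Finset.mem_insert, Prod.mk.injEq]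
      have := (h02 a b).1 hab
      clear * - this
      tauto) hb2.le ((h02 _ _).2 (by simp))
    (hb2.edge _ _ (Finset.mem_insert_self _ _)
      (by simp [hP3, hP2, src_insert, hj, hij.symm, hjm]))
  obtain ⟨Tc, hc1, hc2, hc3⟩ := ih (insert (i, m) P2)
    (hs2.trans_ssubset (Finset.ssubset_insert hmiP2.1))
    (Reach.of_dominated hdom (hs2.trans (Finset.subset_insert _ _))
      (hP2a.insert hmi.symm hmiP2.2) j
      (by simp [hP2, src_insert, hj, hjm])
      (fun x hx hx' => by
        simp only [hP2, src_insert, Finset.mem_insert, Prod.mk.injEq] at hx' ⊢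
        clear * - hx hx'
        tauto)) (after Q N1)
  obtain ⟨N2, h21, h22, h23, h24, h25, h26⟩ := exists_branch hmi.symm hmiP2 h11 hc1 h12 hc2.le
    (h13 _ _ ((h02 _ _).2 (by simp)) (fun h => hij h.1))
    (hc2.edge _ _ (Finset.mem_insert_self _ _) (by simp [hP2, src_insert, hi, hmi.symm]))
  obtain ⟨Td, hd1, hd2, hd3⟩ := ih (insert (m, j) P) (Finset.ssubset_insert (hj m))
    (Reach.of_dominated hdom (Finset.subset_insert _ _)
      (hP.insert hjm.symm (hm j)) m
      (by simp [src_insert, hm, hjm.symm])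
      (fun x hx hx' => by
        simp only [src_insert, Finset.mem_insert, Prod.mk.injEq] at hx' ⊢
        clear * - hx hx'
        tauto)) (after Q N2)
  obtain ⟨N3, h31, h32, h33, h34, h35, h36⟩ := exists_branch hjm.symm ⟨hj m, hm j⟩ h21 hd1 h22
    hd2.le
    (h23 _ _ (h13 _ _ ((h02 _ _).2 (by simp)) (fun h => hij h.2.symm)) (fun h => hmi h.1))
    (hd2.edge _ _ (Finset.mem_insert_self _ _) (by simp [src_insert, hm, hjm.symm]))
  refine ⟨N3, h31, ⟨fun a b hab ha => ?_, h32⟩, ?_⟩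
  -- Edges out of `m` come from `Td`, where `m` is still minimal; all others come from `Tc`, where
  -- only `m` has lost minimality.
  · by_cases ham : a = m
    · subst ham
      refine h34 _ _ (hd2.edge _ _ (Finset.mem_insert_of_mem hab)
        (by simp [src_insert, ha, hjm.symm])) ?_
      exact fun h => hj a (h.1 ▸ hab)
    · refine h33 _ _ (h24 _ _ (hc2.edge _ _ (by simp [hP2, hab])
        (by simp [hP2, src_insert, ha, ham])) ?_) ?_
      · rintro ⟨rfl, rfl⟩
        exact hm _ hab
      · rintro ⟨rfl, rfl⟩
        exact hm _ hab
  · have e1 := Nat.mul_le_mul_left c h04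
    have e2 := Nat.mul_le_mul_left c h16
    have e3 := Nat.mul_le_mul_left c h26
    have e4 := Nat.mul_le_mul_left c h36
    have u1 := card_undominated_le (insert (j, i) P3)
    have u2 := card_undominated_le (insert (i, m) P2)
    have u3 := card_undominated_le (insert (m, j) P)
    rw [mul_add, mul_one] at e1
    omega

/-- One edge of the cycle `h`, `j`, `i` is already in `P`, so only two side branches arise. -/
theorem solvable_of_unknown_edge (hg : IsGuard r s) {K c : ℕ} (hc : 2 * K + 12 * n + 6 ≤ c)
    {Q : Set (Clause (EdgeVar n))} {P : Finset (Fin n × Fin n)} (hP : Asym P)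
    (hdom : ∀ b, ¬ Src P b → ∃ a, Src P a ∧ (a, b) ∈ P)
    (ih : ∀ P', P ⊂ P' → Reach P' → ∀ Q, Solvable (GGT n r s) K c Q P')
    {h j i : Fin n} (hh : Src P h) (hi : Src P i) (hhi : h ≠ i) (hhj : (h, j) ∈ P)
    (hij : (i, j) ∉ P) (hQ : (h, j, i) ∈ unknown Q) (hf : Free P (r h j i) (s h j i)) :
    Solvable (GGT n r s) K c Q P := by
  have hji : j ≠ i := by rintro rfl; exact hi _ hhj
  have hhj' := hP.ne hhj
  set P1 := insert (i, h) P with hP1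
  have hP1a : Asym P1 := hP.insert hhi.symm (hi h)
  have hs1 : P ⊆ P1 := Finset.subset_insert _ _
  have hijP1 : Free P1 i j := by simp [Free, hP1, hij, hi j, hhj'.symm, hji]
  obtain ⟨T0, h01, h02, h03, h04⟩ := exists_learn hg hhj' hji hhi.symm
    (P' := insert (j, i) P1) hQ hf (by
      simp only [hP1, Finset.mem_insert, Prod.mk.injEq]
      clear * -
      tauto)
  obtain ⟨Tb, hb1, hb2, hb3⟩ := ih (insert (i, j) P1)
    (hs1.trans_ssubset (Finset.ssubset_insert hijP1.1))
    (Reach.of_dominated hdom (hs1.trans (Finset.subset_insert _ _))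
      (hP1a.insert hji.symm hijP1.2) i
      (by simp [hP1, src_insert, hi, hhi.symm, hji.symm])
      (fun x hx hx' => by
        simp only [hP1, src_insert, Finset.mem_insert, Prod.mk.injEq] at hx' ⊢
        clear * - hx hx'
        tauto)) (after Q T0)
  obtain ⟨N1, h11, h12, h13, h14, h15, h16⟩ := exists_branch hji.symm hijP1 h01 hb1
    (fun a b hab => by
      simp only [hP1, Finset.mem_insert, Prod.mk.injEq]
      rcases (h02 a b).1 hab with ⟨rfl, rfl⟩ | h | h
      · exact Or.inr (Or.inr hhj)
      · exact Or.inl h.symm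
      · exact Or.inr (Or.inl h.symm)) hb2.le ((h02 _ _).2 (by simp))
    (hb2.edge _ _ (Finset.mem_insert_self _ _)
      (by simp [hP1, src_insert, hi, hhi.symm, hji.symm]))
  obtain ⟨Tc, hc1, hc2, hc3⟩ := ih (insert (h, i) P) (Finset.ssubset_insert (hi h))
    (Reach.of_dominated hdom (Finset.subset_insert _ _)
      (hP.insert hhi (hh i)) h
      (by simp [src_insert, hh, hhi])
      (fun x hx hx' => by
        simp only [src_insert, Finset.mem_insert, Prod.mk.injEq] at hx' ⊢
        clear * - hx hx'
        tauto)) (after Q N1)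
  obtain ⟨N2, h21, h22, h23, h24, h25, h26⟩ := exists_branch hhi ⟨hi h, hh i⟩ h11 hc1 h12 hc2.le
    (h13 _ _ ((h02 _ _).2 (by simp)) (fun h => hhi h.1))
    (hc2.edge _ _ (Finset.mem_insert_self _ _) (by simp [src_insert, hh, hhi]))
  refine ⟨N2, h21, ⟨fun a b hab ha => ?_, h22⟩, ?_⟩
  -- Edges out of `h` come from `Tc`, where `h` stays minimal; all others come from `Tb`, where `h`
  -- is the only minimal element of `P` that is lost.
  · by_cases hah : a = h
    · subst hah
      exact h24 _ _ (hc2.edge _ _ (Finset.mem_insert_of_mem hab) (by simp [src_insert, ha, hhi]))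
        (fun h' => by
          obtain ⟨rfl, -⟩ := h'
          exact hi _ hab)
    · refine h23 _ _ (h14 _ _ (hb2.edge _ _ (by simp [hP1, hab]) ?_) ?_) ?_
      · simp only [hP1, src_insert]
        exact ⟨⟨ha, hah⟩, by rintro rfl; exact ha _ hhj⟩
      · rintro ⟨rfl, rfl⟩
        exact hij hab
      · rintro ⟨rfl, rfl⟩
        exact hh _ hab
  · have e1 := Nat.mul_le_mul_left c h04
    have e2 := Nat.mul_le_mul_left c h16
    have e3 := Nat.mul_le_mul_left c h26
    have u1 := card_undominated_le (insert (i, j) P1)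
    have u2 := card_undominated_le (insert (h, i) P)
    rw [mul_add, mul_one] at e1
    omega

theorem solvable (hn : 1 ≤ n) (hg : IsGuard r s) {K c : ℕ} (hK : 11 * n ^ 3 ≤ K)
    (hc : 2 * K + 12 * n + 6 ≤ c) (P : Finset (Fin n × Fin n)) :
    Reach P → ∀ Q, Solvable (GGT n r s) K c Q P := by
  induction P using WellFoundedGT.induction with
  | ind P ih =>
  intro hP Q
  replace ih : ∀ P', P ⊂ P' → Reach P' → ∀ Q, Solvable (GGT n r s) K c Q P' :=
    fun P' h => ih P' h
  by_cases hdom : ∀ b, ¬ Src P b → ∃ a, Src P a ∧ (a, b) ∈ P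
  swap
  · push Not at hdom
    obtain ⟨b, hb, hb'⟩ := hdom
    exact solvable_of_undominated hg hP ih (mem_undominated.2 ⟨hb, hb'⟩)
  by_cases hE : ∀ h i j, Src P h → Src P i → h ≠ i → (h, j) ∈ P → (i, j) ∉ P →
      ∃ E ∈ GGT n r s ∪ Q, ExtendsTrans P h j i E
  swap
  · push Not at hE
    obtain ⟨h, i, j, hh, hi, hhi, hhj, hij, hno⟩ := hE
    have hji : j ≠ i := by rintro rfl; exact hi _ hhj
    rcases avail_or_free hg (hP.asym.ne hhj) hji hhi.symm Q P with ⟨E, h1, h2⟩ | ⟨h1, h2⟩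
    · exact (hno E h1 h2).elim
    · exact solvable_of_unknown_edge hg hc hP.asym hdom ih hh hi hhi hhj hij h1 h2
  by_cases hE' : ∀ j m i, Src P j → Src P m → Src P i → j ≠ m → m ≠ i → i ≠ j →
      ∃ E ∈ GGT n r s ∪ Q, ExtendsTrans P j m i E
  swap
  · push Not at hE'
    obtain ⟨j, m, i, hj, hm, hi, hjm, hmi, hij, hno⟩ := hE'
    rcases avail_or_free hg hjm hmi hij Q P with ⟨E, h1, h2⟩ | ⟨h1, h2⟩
    · exact (hno E h1 h2).elim
    · exact solvable_of_unknown_src hg hc hP.asym hdom ih hj hm hi hjm hmi hij h1 h2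
  obtain ⟨T, h1, h2, h3⟩ := exists_covers_of_avail (G := GGT n r s ∪ Q) hn hP.asym hdom
    (fun i => Or.inl (Or.inl ⟨i, rfl⟩)) hE hE'
  -- `T` was built with the clauses of `Q` as axioms; here they become known clauses again.
  refine ⟨T, ⟨by simpa using h1.leaves.of_union, h1.inferences, h1.regular, h1.vars⟩, h2, ?_⟩
  have := Nat.mul_le_mul_left c (card_unknown_after_le Q T)
  omega

/-! ### The size of the refutation -/

theorem card_clause_le (C : Clause (EdgeVar n)) : C.card ≤ 2 * n ^ 2 := by
  refine (Finset.card_le_univ C).trans ?_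
  rw [Fintype.card_prod, Fintype.card_bool]
  have := Fintype.card_subtype_le fun p : Fin n × Fin n => p.1 < p.2
  rw [Fintype.card_prod, Fintype.card_fin] at this
  nlinarith

theorem size_le (T : ProofTree (EdgeVar n)) : T.size ≤ T.lines * (2 * n ^ 2 + 1) := by
  unfold ProofTree.size ProofTree.lines
  refine (List.sum_le_card_nsmul _ (2 * n ^ 2 + 1) ?_).trans_eq (by simp)
  intro x hx
  obtain ⟨C, -, rfl⟩ := List.mem_map.1 hx
  exact Nat.succ_le_succ (card_clause_le C)

end PoolRes

theorem mainTheorem1 :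
    ∃ c : ℕ, ∀ n : ℕ, 1 ≤ n → ∀ r s : Fin n → Fin n → Fin n → Fin n, PoolRes.IsGuard r s →
      ∃ T : PoolRes.ProofTree (PoolRes.EdgeVar n),
        PoolRes.IsPoolRefutation (PoolRes.GGT n r s) T ∧
        T.lines ≤ c * n ^ 6 ∧ T.size ≤ c * n ^ 8 := by
  -- With `K = 11 * n ^ 3`, the bound `2 * K + 12 * n + 6 ≤ 40 * n ^ 3` gives `c`. The line count is
  -- then at most $(11 + 4 + 40)n^6$, and each line has size at most $2n^2 + 1 \le 3n^2$, whence
  -- $165 = 55 \cdot 3$.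
  refine ⟨165, fun n hn r s hg => ?_⟩
  obtain ⟨T, h1, h2, h3⟩ := PoolRes.solvable (P := ∅) (K := 11 * n ^ 3) (c := 40 * n ^ 3) hn hg
    le_rfl (by nlinarith [Nat.one_le_pow 3 n hn, Nat.le_self_pow (show 3 ≠ 0 by norm_num) n])
    ⟨fun a b h => by simp at h, fun b hb => (hb fun a => by simp).elim⟩ ∅
  have hlines : T.lines ≤ 55 * n ^ 6 := by
    have hu := Nat.mul_le_mul_left (40 * n ^ 3) (PoolRes.card_unknown_le (n := n) ∅)
    have hb := PoolRes.card_undominated_le (n := n) ∅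
    have h36 : n ^ 3 ≤ n ^ 6 := Nat.pow_le_pow_right hn (by norm_num)
    have h16 : n ≤ n ^ 6 := Nat.le_self_pow (by norm_num) n
    have : 40 * n ^ 3 * n ^ 3 = 40 * n ^ 6 := by ring
    omega
  refine ⟨T, ⟨?_, h1.leaves, h1.inferences, h1.regular, by simp⟩, hlines.trans (by gcongr; norm_num),
    ?_⟩
  · exact PoolRes.eq_empty_of_not_has fun a b hab => by simpa using h2.le a b hab
  · calc T.size ≤ T.lines * (2 * n ^ 2 + 1) := PoolRes.size_le T
      _ ≤ 55 * n ^ 6 * (2 * n ^ 2 + n ^ 2) := by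
        gcongr
        exact Nat.one_le_pow 2 n hn
      _ = 165 * n ^ 8 := by ring
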